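/- \textbf{Types.} Let $\mathcal S$ be a set of sorts. Types are $T ::= \mathsf A \mid T\to U$ with $\mathsf A\in\mathcal S$; the arity is $\alpha(\mathsf A)=0$, $\alpha(T\to U)=1+\alpha(U)$. Write $T\to U\rhd_l T$ and $T\to U\rhd_r U$. Let $>$ be a strict ordering on types, with reflexive closure $\ge$, that is \emph{admissible}: (i) $\rhd_r\,\subseteq\, >$; (ii) $\succ\;:=({>}\cup{\rhd_l})^+$ is well-founded; (iii) if $T\to U>V$ then $U\ge V$ or $V=T\to U'$ with $U>U'$. \textbf{Terms.} Let $\mathcal X$ be a set of variables $x$, each with a type $\tau(x)$, infinitely many of each type, and $\mathcal F$ a set of function symbols, each $f$ having a type and an arity $n_f$ at most the arity of its type. Terms are the simply typed $\lambda$-terms $x$, $f(t_1,\dots,t_{n_f})$, $tu$, $\lambda x\,t$ (if $f$ has type $T_1\to\dots\to T_{n_f}\to U$ and $t_i:T_i$, then $f(\vec t):U$), considered up to renaming of bound variables by variables of the same type. $\tau(t)$ is the type of $t$, $t:T$ means $\tau(t)=T$, and $t_x^u$ is the capture-avoiding substitution of $u$ for $x$ in $t$. \textbf{Core CPO.} Let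 $\ge_{\mathcal F}$ be a quasi-ordering on $\mathcal F$ with equivalence $\simeq_{\mathcal F}$ and well-founded strict part $>_{\mathcal F}$, and let $\mathrm{stat}(f)\in\{\mathrm{mul}\}\cup\{\mathrm{lex}(n)\mid n\ge2\}$ with equivalent symbols having the same status. For a relation $R$ on terms, $R_{\mathrm{mul}}$ compares sequences by the multiset extension of $R$ (the transitive closure of replacing one element by finitely many $R$-smaller ones), and $\vec t\,R_{\mathrm{lex}(n)}\,\vec u$ iff for some $1\le j\le n$, $t_j\,R\,u_j$ and $t_i=u_i$ for all $i<j$. The relations $>^Y$ on terms, for $Y\subseteq\mathcal X$ finite, are defined simultaneously and inductively by the rules below. There, $t>^Y_\tau u$ means $t>^Y u$ and $\tau(t)\ge\tau(u)$; $\ge^Y$ and $\ge^Y_\tau$ are the reflexive closures of $>^Y$ and $>^Y_\tau$; a variable $z$ is always such that $z$ is not free in either side of the compared pair, $z\notin Y$, and $z$ has the same type as the variable it replaces. \begin{itemize} \item $f(\vec t)>^Y v$ if $t_i\ge^\emptyset_\tau v$ for some $i$; \item $f(\vec t)>^Y g(\vec u)$ if $f\simeq_{\mathcal F}g$, $f(\vec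 t)>^Y u_i$ for all $i$, and $\vec t\,(>^\emptyset_\tau)_{\mathrm{stat}(f)}\,\vec u$; \item $f(\vec t)>^Y g(\vec u)$ if $f>_{\mathcal F}g$ and $f(\vec t)>^Y u_i$ for all $i$; \item $f(\vec t)>^Y uv$ if $f(\vec t)>^Y u$ and $f(\vec t)>^Y v$; \item $f(\vec t)>^Y\lambda y\,v$ if $f(\vec t)>^{Y\cup\{z\}}v_y^z$; \item $f(\vec t)>^Y y$, $tu>^Y y$ and $\lambda x\,t>^Y y$ if $y\in Y$; \item $tu>^Y v$ if $t\ge^Y v$ or $u\ge^Y_\tau v$; \item $tu>^Y t'u'$ if either $t=t'$ and $u>^Y u'$, or, for each $v\in\{t',u'\}$, one of $t>^Y_\tau v$, $u\ge^Y_\tau v$, $tu>^Y_\tau v$ holds; \item $tu>^Y\lambda y\,v$ if $tu>^Y v_y^z$; \item $(\lambda x\,t)u>^Y v$ if $t_x^u\ge^Y v$; \item $\lambda x\,t>^Y v$ if $t_x^z\ge^Y_\tau v$; \item $\lambda x\,t>^Y\lambda y\,v$ if $\tau(x)=\tau(y)$ and $t_x^z>^Y v_y^z$; \item $\lambda x\,t>^Y\lambda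 y\,v$ if $\tau(x)\ne\tau(y)$ and $\lambda x\,t>^Y v_y^z$; \item $\lambda x(tx)>^Y v$ if $t\ge^Y v$ and $x$ is not free in $t$. \end{itemize} Core CPO is $>^\emptyset_\tau$. Let $\mathrm{SN}(>^\emptyset_\tau)$ be the set of terms from which there is no infinite sequence of $>^\emptyset_\tau$-steps; a \emph{reduct} of $t$ is a term $u$ with $t>^\emptyset_\tau u$. \textbf{Interpretation of types.} A map $I$ sending each sort $\mathsf A$ to a set of terms of type $\mathsf A$ extends to types by $[\![\mathsf A]\!]_I=I(\mathsf A)$ and $[\![U\to V]\!]_I=\{t: U\to V\mid \forall u\in[\![U]\!]_I,\ tu\in[\![V]\!]_I\}$. Let $I$ be defined by well-founded recursion along $\succ$ on sorts: $I(\mathsf A)$ is the least fixpoint of the monotone function $$F_{\mathsf A}(C)=\{t:\mathsf A\mid \forall u,U,\ (t>^\emptyset_\tau u \text{ and } u:U)\Rightarrow u\in[\![U]\!]_{I\cup\{(\mathsf A,C)\}}\},$$ where $I$ on the right is the restriction to the sorts $\mathsf B\prec\mathsf A$. Write $[\![T]\!]=[\![T]\!]_I$, and call $t:T$ \emph{computable}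 if $t\in[\![T]\!]$. Let $\mathcal N$ (neutral terms) be the smallest set of terms containing all variables, all terms $f(\vec t)$ and all terms $(\lambda x\,t)u$, and containing $tu$ whenever it contains $t$. \textbf{Theorem.} For every type $T$, $[\![T]\!]$ is a computability predicate, i.e. a set of terms of type $T$ such that: \begin{itemize} \item (comp-sn) $[\![T]\!]\subseteq\mathrm{SN}(>^\emptyset_\tau)$; \item (comp-red) if $t\in[\![T]\!]$, then every reduct of $t$ is computable; \item (comp-neutral) if $t:T$, $t\in\mathcal N$ and every reduct of $t$ is computable, then $t\in[\![T]\!]$; \item (comp-lam) if $T=U\to V$, $\lambda x\,t:T$ and $t_x^u$ is computable for every $u\in[\![U]\!]$, then $\lambda x\,t\in[\![T]\!]$. \end{itemize} -/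

import Mathlib

universe u v w

namespace CPO

/-! ### Types and admissible type orderings -/

/-- Simple types over a set `S` of sorts. -/
inductive Ty (S : Type u) : Type u
  | sort (A : S) : Ty S
  | arrow (T U : Ty S) : Ty S

infixr:60 " ⇒ " => Ty.arrow

namespace Ty

variable {S : Type u}

/-- The arity of a type. -/
def arity : Ty S → ℕ
  | sort _ => 0
  | _ ⇒ U => 1 + U.arity

/-- `arrows [T₁, …, Tₙ] U` is `T₁ ⇒ … ⇒ Tₙ ⇒ U`. -/
def arrows (Ts : List (Ty S)) (U : Ty S) : Ty S := Ts.foldr Ty.arrow U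

/-- `T` has `U` as immediate left subterm. -/
def LeftSub (T U : Ty S) : Prop := ∃ V, T = U ⇒ V

/-- `T` has `U` as immediate right subterm. -/
def RightSub (T U : Ty S) : Prop := ∃ V, T = V ⇒ U

/-- The sort `A` occurs in a type. -/
def Occurs (A : S) : Ty S → Prop
  | sort B => A = B
  | T ⇒ U => T.Occurs A ∨ U.Occurs A

end Ty

/-- The relation `(> ∪ ▷ₗ)⁺` on types. -/
def WfGt {S : Type u} (gt : Ty S → Ty S → Prop) : Ty S → Ty S → Prop :=
  Relation.TransGen fun T U => gt T U ∨ T.LeftSub U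

/-- Admissible (strict) orderings on types. -/
structure TypeOrder (S : Type u) where
  gt : Ty S → Ty S → Prop
  irrefl : ∀ T, ¬ gt T T
  trans : ∀ T U V, gt T U → gt U V → gt T V
  right_subterm : ∀ T U, T.RightSub U → gt T U
  sn : WellFounded fun U T => WfGt gt T U
  of_arrow : ∀ T U V, gt (T ⇒ U) V →
    (U = V ∨ gt U V) ∨ ∃ U', V = T ⇒ U' ∧ gt U U'

/-- The reflexive closure of the type ordering. -/
def TypeOrder.ge {S : Type u} (O : TypeOrder S) (T U : Ty S) : Prop := T = U ∨ O.gt T U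

/-! ### Signatures and terms -/

/-- Variables `X`, each with a type, infinitely many of each type, and function symbols `F`, each
with a type and an arity not greater than the arity of its type. -/
structure Signature (S : Type u) (X : Type v) (F : Type w) where
  varTy : X → Ty S
  varTy_infinite : ∀ T, {x | varTy x = T}.Infinite
  funTy : F → Ty S
  ar : F → ℕ
  ar_le : ∀ f, ar f ≤ (funTy f).arity

variable {S : Type u} {X : Type v} {F : Type w}

/-- Raw terms in locally nameless style: a variable bound by an abstraction is written as a de
Bruijn index, free variables are named, and an abstraction carries the type of the variable that it
binds. The raw terms having a type in the empty context are the simply typed terms up to renaming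
of bound variables by variables of the same type. -/
inductive Pre (sig : Signature S X F) : Type (max u v w)
  | bvar (n : ℕ) : Pre sig
  | fvar (x : X) : Pre sig
  | fn (f : F) (ts : Fin (sig.ar f) → Pre sig) : Pre sig
  | app (t u : Pre sig) : Pre sig
  | lam (T : Ty S) (t : Pre sig) : Pre sig

/-- Typing of raw terms; the list gives the types of the dangling indices `0, 1, …`. -/
inductive HasType {sig : Signature S X F} : List (Ty S) → Pre sig → Ty S → Prop
  | bvar {Γ n T} (h : Γ[n]? = some T) : HasType Γ (.bvar n) T
  | fvar {Γ} (x : X) : HasType Γ (.fvar x) (sig.varTy x)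
  | fn {Γ f ts} (Ts : Fin (sig.ar f) → Ty S) {U : Ty S}
      (hf : sig.funTy f = Ty.arrows (List.ofFn Ts) U) (hts : ∀ i, HasType Γ (ts i) (Ts i)) :
      HasType Γ (.fn f ts) U
  | app {Γ t u U V} (ht : HasType Γ t (U ⇒ V)) (hu : HasType Γ u U) : HasType Γ (.app t u) V
  | lam {Γ T t U} (ht : HasType (T :: Γ) t U) : HasType Γ (.lam T t) (T ⇒ U)

/-- `OfType t T`: `t` is a term (no dangling index) and its type is `T`. -/
def OfType {sig : Signature S X F} (t : Pre sig) (T : Ty S) : Prop := HasType [] t T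

namespace Pre

variable {sig : Signature S X F}

/-- Free variables. -/
def fv : Pre sig → Set X
  | bvar _ => ∅
  | fvar x => {x}
  | fn _ ts => ⋃ i, (ts i).fv
  | app t u => t.fv ∪ u.fv
  | lam _ t => t.fv

/-- Replace the index `k` by the term `u`. No shifting is needed as `u` has no dangling index. -/
def openAt (u : Pre sig) : ℕ → Pre sig → Pre sig
  | k, bvar n => if n = k then u else bvar n
  | _, fvar x => fvar x
  | k, fn f ts => fn f fun i => openAt u k (ts i)
  | k, app t s => app (openAt u k t) (openAt u k s)
  | k, lam T t => lam T (openAt u (k + 1) t)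

/-- If `lam T t` represents `λx.s` then `t.inst u` represents the capture-avoiding substitution
`s[u/x]`. -/
def inst (t u : Pre sig) : Pre sig := openAt u 0 t

end Pre

/-! ### Statuses -/

/-- Statuses of function symbols. -/
inductive Status
  | mul : Status
  | lex (n : ℕ) (hn : 2 ≤ n) : Status

/-- Replacement of one element of a multiset by finitely many smaller ones. -/
def MulStep {α : Type u} (R : α → α → Prop) (M N : Multiset α) : Prop :=
  ∃ (K : Multiset α) (a : α) (Y : Multiset α), M = K + {a} ∧ N = K + Y ∧ ∀ b ∈ Y, R a b

/-- The extension of a relation to sequences prescribed by a status. -/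
def StatusExt {α : Type u} (R : α → α → Prop) : Status → List α → List α → Prop
  | .mul, ts, us => Relation.TransGen (MulStep R) (ts : Multiset α) (us : Multiset α)
  | .lex n _, ts, us => ∃ (j : ℕ) (ht : j < ts.length) (hu : j < us.length),
      j < n ∧ R ts[j] us[j] ∧ ts.take j = us.take j

/-- A precedence (quasi-ordering with well-founded strict part) on function symbols, and a status
for each symbol, equivalent symbols having the same status. -/
structure Precedence (F : Type w) where
  ge : F → F → Prop
  refl : ∀ f, ge f f
  trans : ∀ f g h, ge f g → ge g h → ge f h
  wf : WellFounded fun g f => ge f g ∧ ¬ ge g f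
  stat : F → Status
  stat_eq : ∀ f g, ge f g → ge g f → stat f = stat g

/-- The equivalence of a precedence. -/
def Precedence.eqv (P : Precedence F) (f g : F) : Prop := P.ge f g ∧ P.ge g f

/-- The strict part of a precedence. -/
def Precedence.gt (P : Precedence F) (f g : F) : Prop := P.ge f g ∧ ¬ P.ge g f

/-! ### The core computability path relation -/

section Relation

variable {sig : Signature S X F}

/-- The restriction of a relation to pairs of terms whose types do not increase. -/
def Typed (O : TypeOrder S) (R : Pre sig → Pre sig → Prop) (t u : Pre sig) : Prop :=
  R t u ∧ ∃ T U, OfType t T ∧ OfType u U ∧ O.ge T U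

/-- Reflexive closure. -/
def Refl {α : Type u} (R : α → α → Prop) (t u : α) : Prop := t = u ∨ R t u

/-- `t u >_@ v`, the auxiliary relation of the second case for two applications. -/
def AppGt (O : TypeOrder S) (R : Pre sig → Pre sig → Prop) (t u v : Pre sig) : Prop :=
  Typed O R t v ∨ Refl (Typed O R) u v ∨ Typed O R (.app t u) v

/-- `z` is fresh for the comparison of `t` and `u` with parameter `Y`. -/
def Fresh (z : X) (t : Pre sig) (Y : Finset X) (u : Pre sig) : Prop :=
  z ∉ t.fv ∧ z ∉ Y ∧ z ∉ u.fv

open Classical in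
/-- One application of a rule of core CPO, whose premises are taken in the family of relations `R`
(`R Y` stands for `>^Y`). -/
inductive Step (O : TypeOrder S) (P : Precedence F) (R : Finset X → Pre sig → Pre sig → Prop) :
    Finset X → Pre sig → Pre sig → Prop
  | big_sub {Y f ts v} (i : Fin (sig.ar f)) (h : Refl (Typed O (R ∅)) (ts i) v) :
      Step O P R Y (.fn f ts) v
  | big_eq {Y f ts g us} (hfg : P.eqv f g) (h : ∀ i, R Y (.fn f ts) (us i))
      (hs : StatusExt (Typed O (R ∅)) (P.stat f) (List.ofFn ts) (List.ofFn us)) :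
      Step O P R Y (.fn f ts) (.fn g us)
  | big_gt {Y f ts g us} (hfg : P.gt f g) (h : ∀ i, R Y (.fn f ts) (us i)) :
      Step O P R Y (.fn f ts) (.fn g us)
  | big_app {Y f ts u v} (hu : R Y (.fn f ts) u) (hv : R Y (.fn f ts) v) :
      Step O P R Y (.fn f ts) (.app u v)
  | big_lam {Y f ts V v} (z : X) (hz : sig.varTy z = V) (hfr : Fresh z (.fn f ts) Y (.lam V v))
      (h : R (insert z Y) (.fn f ts) (v.inst (.fvar z))) :
      Step O P R Y (.fn f ts) (.lam V v)
  | big_var {Y f ts y} (hy : y ∈ Y) : Step O P R Y (.fn f ts) (.fvar y)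
  | app_sub {Y t u v} (h : Refl (R Y) t v ∨ Refl (Typed O (R Y)) u v) :
      Step O P R Y (.app t u) v
  | app_eq {Y t u t' u'}
      (h : (t = t' ∧ R Y u u') ∨ (AppGt O (R Y) t u t' ∧ AppGt O (R Y) t u u')) :
      Step O P R Y (.app t u) (.app t' u')
  | app_lam {Y t u V v} (z : X) (hz : sig.varTy z = V) (hfr : Fresh z (.app t u) Y (.lam V v))
      (h : R Y (.app t u) (v.inst (.fvar z))) :
      Step O P R Y (.app t u) (.lam V v)
  | app_var {Y t u y} (hy : y ∈ Y) : Step O P R Y (.app t u) (.fvar y)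
  | app_beta {Y T t u v} (h : Refl (R Y) (t.inst u) v) : Step O P R Y (.app (.lam T t) u) v
  | lam_sub {Y T t v} (z : X) (hz : sig.varTy z = T) (hfr : Fresh z (.lam T t) Y v)
      (h : Refl (Typed O (R Y)) (t.inst (.fvar z)) v) :
      Step O P R Y (.lam T t) v
  | lam_eq {Y T t v} (z : X) (hz : sig.varTy z = T) (hfr : Fresh z (.lam T t) Y (.lam T v))
      (h : R Y (t.inst (.fvar z)) (v.inst (.fvar z))) :
      Step O P R Y (.lam T t) (.lam T v)
  | lam_neq {Y T t V v} (hTV : T ≠ V) (z : X) (hz : sig.varTy z = V)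
      (hfr : Fresh z (.lam T t) Y (.lam V v)) (h : R Y (.lam T t) (v.inst (.fvar z))) :
      Step O P R Y (.lam T t) (.lam V v)
  | lam_var {Y T t y} (hy : y ∈ Y) : Step O P R Y (.lam T t) (.fvar y)
    /-- Here `t` is required to have no dangling index, that is, the variable bound by the
    abstraction does not occur in it. -/
  | lam_eta {Y T t v V} (ht : OfType t (T ⇒ V)) (h : Refl (R Y) t v) :
      Step O P R Y (.lam T (.app t (.bvar 0))) v

theorem Typed.mono {O : TypeOrder S} {R R' : Pre sig → Pre sig → Prop}
    (h : ∀ a b, R a b → R' a b) {a b : Pre sig} : Typed O R a b → Typed O R' a b :=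
  fun ⟨h₁, h₂⟩ => ⟨h _ _ h₁, h₂⟩

theorem Refl.mono {α : Type u} {R R' : α → α → Prop} (h : ∀ a b, R a b → R' a b) {a b : α} :
    Refl R a b → Refl R' a b :=
  Or.imp_right (h _ _)

theorem AppGt.mono {O : TypeOrder S} {R R' : Pre sig → Pre sig → Prop}
    (h : ∀ a b, R a b → R' a b) {t u v : Pre sig} : AppGt O R t u v → AppGt O R' t u v :=
  Or.imp (Typed.mono h) (Or.imp (Refl.mono fun _ _ => Typed.mono h) (Typed.mono h))

theorem StatusExt.mono {α : Type u} {R R' : α → α → Prop} (h : ∀ a b, R a b → R' a b)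
    {s : Status} {ts us : List α} : StatusExt R s ts us → StatusExt R' s ts us := by
  cases s with
  | mul =>
    have hm : ∀ M N : Multiset α, MulStep R M N → MulStep R' M N := by
      rintro M N ⟨K, a, Y, hM, hN, hY⟩
      exact ⟨K, a, Y, hM, hN, fun b hb => h _ _ (hY b hb)⟩
    exact fun hs => Relation.TransGen.mono (r := MulStep R) (p := MulStep R') hm _ _ hs
  | lex n hn =>
    rintro ⟨j, ht, hu, hj, hR, he⟩
    exact ⟨j, ht, hu, hj, h _ _ hR, he⟩

theorem Step.mono (O : TypeOrder S) (P : Precedence F) :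
    Monotone (Step (sig := sig) O P) := by
  intro R R' h Y a b hs
  have hT : ∀ Y a b, Typed O (R Y) a b → Typed O (R' Y) a b := fun Y a b => Typed.mono (h Y)
  cases hs with
  | big_sub i h₁ => exact .big_sub i (Refl.mono (hT ∅) h₁)
  | big_eq hfg h₁ hs => exact .big_eq hfg (fun i => h _ _ _ (h₁ i)) (StatusExt.mono (hT ∅) hs)
  | big_gt hfg h₁ => exact .big_gt hfg fun i => h _ _ _ (h₁ i)
  | big_app hu hv => exact .big_app (h _ _ _ hu) (h _ _ _ hv)
  | big_lam z hz hfr h₁ => exact .big_lam z hz hfr (h _ _ _ h₁)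
  | big_var hy => exact .big_var hy
  | app_sub h₁ => exact .app_sub (h₁.imp (Refl.mono (h Y)) (Refl.mono (hT Y)))
  | app_eq h₁ =>
    exact .app_eq (h₁.imp (And.imp_right (h _ _ _)) (And.imp (AppGt.mono (h Y)) (AppGt.mono (h Y))))
  | app_lam z hz hfr h₁ => exact .app_lam z hz hfr (h _ _ _ h₁)
  | app_var hy => exact .app_var hy
  | app_beta h₁ => exact .app_beta (Refl.mono (h Y) h₁)
  | lam_sub z hz hfr h₁ => exact .lam_sub z hz hfr (Refl.mono (hT Y) h₁)
  | lam_eq z hz hfr h₁ => exact .lam_eq z hz hfr (h _ _ _ h₁)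
  | lam_neq hTV z hz hfr h₁ => exact .lam_neq hTV z hz hfr (h _ _ _ h₁)
  | lam_var hy => exact .lam_var hy
  | lam_eta ht h₁ => exact .lam_eta ht (Refl.mono (h Y) h₁)

/-- The relations `>^Y`, inductively defined by the rules: the least family closed under them. -/
def Gt (O : TypeOrder S) (P : Precedence F) : Finset X → Pre sig → Pre sig → Prop :=
  OrderHom.lfp ⟨Step O P, Step.mono O P⟩

/-- Core CPO: the relation `>^∅` restricted to pairs of terms whose types do not increase. -/
def Core (O : TypeOrder S) (P : Precedence F) : Pre sig → Pre sig → Prop :=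
  Typed O (Gt O P ∅)

end Relation

/-! ### Computability -/

section Computability

variable {sig : Signature S X F}

/-- The terms of `SN(R)`: those from which there is no infinite sequence of `R`-steps. -/
def SN (R : Pre sig → Pre sig → Prop) : Set (Pre sig) :=
  {t | (∃ T, OfType t T) ∧ ¬ ∃ s : ℕ → Pre sig, s 0 = t ∧ ∀ n, R (s n) (s (n + 1))}

/-- The extension of a base type interpretation to all types. -/
def interp (I : S → Set (Pre sig)) : Ty S → Set (Pre sig)
  | .sort A => I A
  | U ⇒ V => {t | OfType t (U ⇒ V) ∧ ∀ u, u ∈ interp I U → .app t u ∈ interp I V}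

/-- A term of type `T` is computable if it belongs to the interpretation of `T`. -/
def Computable (I : S → Set (Pre sig)) (t : Pre sig) : Prop :=
  ∃ T, OfType t T ∧ t ∈ interp I T

/-- `C` is a set of terms of type `T` that is a computability predicate with respect to the
relation `R`, the set `N` of neutral terms and the base type interpretation `I`. -/
structure IsCompPred (R : Pre sig → Pre sig → Prop) (N : Set (Pre sig)) (I : S → Set (Pre sig))
    (T : Ty S) (C : Set (Pre sig)) : Prop where
  typed : ∀ t ∈ C, OfType t T
  comp_sn : C ⊆ SN R
  comp_red : ∀ t ∈ C, ∀ u, R t u → Computable I u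
  comp_neutral : ∀ t, OfType t T → t ∈ N → (∀ u, R t u → Computable I u) → t ∈ C
  comp_lam : ∀ U V t, T = U ⇒ V → OfType (.lam U t) T →
    (∀ u ∈ interp I U, Computable I (t.inst u)) → .lam U t ∈ C

/-- Neutral terms for core CPO. -/
inductive Neutral : Pre sig → Prop
  | var (x : X) : Neutral (.fvar x)
  | fn (f : F) (ts : Fin (sig.ar f) → Pre sig) : Neutral (.fn f ts)
  | beta (T : Ty S) (t u : Pre sig) : Neutral (.app (.lam T t) u)
  | app (t u : Pre sig) (ht : Neutral t) : Neutral (.app t u)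

open Classical in
/-- The function `F_A`, where `I` gives the interpretation of the sorts smaller than `A`. -/
def sortOp (O : TypeOrder S) (P : Precedence F) (I : S → Set (Pre sig)) (A : S)
    (C : Set (Pre sig)) : Set (Pre sig) :=
  {t | OfType t (.sort A) ∧
    ∀ u U, Core O P t u → OfType u U → u ∈ interp (Function.update I A C) U}

theorem arrows_ofFn_inj {n : ℕ} {Ts Ts' : Fin n → Ty S} {U U' : Ty S}
    (h : Ty.arrows (List.ofFn Ts) U = Ty.arrows (List.ofFn Ts') U') : U = U' := by
  induction n with
  | zero => simpa [Ty.arrows] using h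
  | succ n ih =>
    simp only [List.ofFn_succ, Ty.arrows, List.foldr_cons, Ty.arrow.injEq] at h
    exact ih h.2

/-- A term has at most one type. -/
theorem HasType.unique {Γ : List (Ty S)} {t : Pre sig} {T T' : Ty S} (h : HasType Γ t T)
    (h' : HasType Γ t T') : T = T' := by
  induction h generalizing T' with
  | bvar h => cases h' with | bvar h' => exact Option.some.inj (h.symm.trans h')
  | fvar x => cases h'; rfl
  | fn Ts hf hts ih => cases h' with | fn Ts' hf' hts' => exact arrows_ofFn_inj (hf.symm.trans hf')
  | app ht hu ih₁ ih₂ =>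
    cases h' with | app ht' hu' => have := ih₁ ht'; simp only [Ty.arrow.injEq] at this; exact this.2
  | lam ht ih => cases h' with | lam ht' => rw [ih ht']

theorem interp_congr {I J : S → Set (Pre sig)} (T : Ty S) (h : ∀ A, T.Occurs A → I A = J A) :
    interp I T = interp J T := by
  induction T with
  | sort A => exact h A rfl
  | arrow U V ihU ihV =>
    simp only [interp, ihU fun A hA => h A (Or.inl hA), ihV fun A hA => h A (Or.inr hA)]

theorem TypeOrder.wfGt_of_occurs (O : TypeOrder S) (A : S) (T : Ty S) (h : T.Occurs A) :
    T = .sort A ∨ WfGt O.gt T (.sort A) := by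
  induction T with
  | sort B => left; rw [show A = B from h]
  | arrow U V ihU ihV =>
    right
    rcases h with h | h
    · have h₁ : WfGt O.gt (U ⇒ V) U := .single (Or.inr ⟨V, rfl⟩)
      rcases ihU h with e | h₂
      · exact e ▸ h₁
      · exact Relation.TransGen.trans h₁ h₂
    · have h₁ : WfGt O.gt (U ⇒ V) V := .single (Or.inl (O.right_subterm _ _ ⟨U, rfl⟩))
      rcases ihV h with e | h₂
      · exact e ▸ h₁
      · exact Relation.TransGen.trans h₁ h₂

theorem TypeOrder.wfGt_irrefl (O : TypeOrder S) (T : Ty S) : ¬ WfGt O.gt T T :=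
  fun h => O.sn.irrefl.irrefl T h

/-- Every sort occurring in a type smaller than `A` is smaller than `A`. -/
theorem TypeOrder.occurs_of_gt (O : TypeOrder S) {A B : S} {U : Ty S} (h : O.gt (.sort A) U)
    (hB : U.Occurs B) : WfGt O.gt (.sort A) (.sort B) := by
  have h₁ : WfGt O.gt (.sort A) U := .single (Or.inl h)
  rcases O.wfGt_of_occurs B U hB with e | h₂
  · exact e ▸ h₁
  · exact Relation.TransGen.trans h₁ h₂

theorem Core.type_ge {O : TypeOrder S} {P : Precedence F} {t u : Pre sig} {T U : Ty S}
    (h : Core O P t u) (ht : OfType t T) (hu : OfType u U) : O.ge T U := by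
  obtain ⟨-, T', U', ht', hu', h⟩ := h
  rwa [HasType.unique ht ht', HasType.unique hu hu']

open Classical in
theorem sortOp_mono (O : TypeOrder S) (P : Precedence F) (I : S → Set (Pre sig)) (A : S) :
    Monotone (sortOp O P I A) := by
  rintro C C' hC t ⟨ht, h⟩
  refine ⟨ht, fun u U hu hU => ?_⟩
  have h₁ := h u U hu hU
  rcases hu.type_ge ht hU with rfl | hgt
  · simp only [interp, Function.update_self] at h₁ ⊢
    exact hC h₁
  · rwa [interp_congr U (J := Function.update I A C) fun B hB => ?_]
    have : B ≠ A := by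
      rintro rfl
      exact O.wfGt_irrefl _ (O.occurs_of_gt hgt hB)
    simp [Function.update_of_ne this]

open Classical in
/-- `F_A` only depends on the interpretation of the sorts smaller than `A`. -/
theorem sortOp_congr (O : TypeOrder S) (P : Precedence F) {I J : S → Set (Pre sig)} {A : S}
    (h : ∀ B, WfGt O.gt (.sort A) (.sort B) → I B = J B) : sortOp O P I A = sortOp O P J A := by
  have key : ∀ (C : Set (Pre sig)) (t u : Pre sig) (U : Ty S), OfType t (.sort A) →
      Core O P t u → OfType u U → interp (Function.update I A C) U =
        interp (Function.update J A C) U := by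
    intro C t u U ht hu hU
    refine interp_congr U fun B hB => ?_
    by_cases e : B = A
    · subst e; simp
    · rw [Function.update_of_ne e, Function.update_of_ne e]
      rcases hu.type_ge ht hU with rfl | hgt
      · exact absurd hB e
      · exact h B (O.occurs_of_gt hgt hB)
  funext C
  ext t
  constructor
  · rintro ⟨ht, h'⟩
    exact ⟨ht, fun u U hu hU => key C t u U ht hu hU ▸ h' u U hu hU⟩
  · rintro ⟨ht, h'⟩
    exact ⟨ht, fun u U hu hU => (key C t u U ht hu hU).symm ▸ h' u U hu hU⟩

theorem sort_wf (O : TypeOrder S) :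
    WellFounded fun B A : S => WfGt O.gt (.sort A) (.sort B) :=
  InvImage.wf Ty.sort O.sn

open Classical in
/-- The base type interpretation: by well-founded recursion, the interpretation of a sort `A` is
the least fixpoint of `F_A`. -/
def baseInterp (sig : Signature S X F) (O : TypeOrder S) (P : Precedence F) :
    S → Set (Pre sig) :=
  (sort_wf O).fix fun A rec =>
    OrderHom.lfp ⟨sortOp O P (fun B => if h : WfGt O.gt (.sort A) (.sort B) then rec B h else ∅) A,
      sortOp_mono O P _ A⟩

/-- The interpretation of `A` is the least fixpoint of `F_A`. -/
theorem baseInterp_eq (sig : Signature S X F) (O : TypeOrder S) (P : Precedence F) (A : S) :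
    baseInterp sig O P A =
      OrderHom.lfp ⟨sortOp O P (baseInterp sig O P) A, sortOp_mono O P _ A⟩ := by
  rw [baseInterp, WellFounded.fix_eq]
  congr 2
  refine sortOp_congr O P fun B hB => ?_
  rw [dif_pos hB]

end Computability

end CPO

/-!
The interpretation of every type is shown to be a computability predicate by well-founded induction
along `WfGt O.gt`, the relation `(> ∪ ▷ₗ)⁺`.

At a sort `A`, the fixpoint equation says that `t : A` is computable iff all its reducts are
(`mem_interp_sort_iff`), which is (comp-red) and (comp-neutral); (comp-sn) is an induction on the
least fixpoint, and (comp-lam) is void.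

At `U ⇒ V`, the starting point is that a step `t > t'` gives a step from `t u`, either to `t'`
(`Core.app_of_ge`) or to `t' u` (`Core.app_of_arrow`); which one is dictated by the third axiom of
admissible orderings. Since computability at `U ⇒ V` is defined by applications, and the induction
hypothesis yields variables as computable arguments, (comp-sn) and (comp-red) descend from `V` to
`U ⇒ V`. For the two other properties, `mem_interp_arrow` shows that `t : U ⇒ V` is computable as
soon as its reducts are, the `t u` are neutral and, when `t` is an abstraction, its instances by
computable terms are computable: one proves that the reducts of `t u` are computable, by induction
first on the strongly normalizing `u`, then on the size of the reduct. This gives (comp-neutral) at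
once, and (comp-lam) once the reducts of the abstraction are known to be computable
(`Core.computable_of_lam`). Some of these are abstractions of the same type, so that (comp-lam) is
itself proved by induction, on an instance of the body by a variable, which is strongly normalizing.

Two facts on `>^Y` serve to handle reducts that are abstractions. A term `v` with `t >^Y v` has no
free variables besides those of `t` and `Y` (`Gt.fv_subset`). Hence the rules that compare `t` with
`λy v` by comparing it with `v[z/y]`, for `z` fresh, without adding `z` to `Y`, only apply when `y`
is not free in `v`, so that all instances of `v` are equal. And `>^Y` is stable under substitution
(`Gt.subst`), so that `t[z/x] > v[z/y]` for one fresh `z` gives `t[w/x] > v[w/y]` for all `w`.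
-/

namespace CPO

variable {S : Type u} {X : Type v} {F : Type w} {sig : Signature S X F}

/-! ### Opening, free variables and substitution -/

namespace Pre

/-- The number of applications and abstractions of a term that are not inside an argument of a
function symbol. -/
def size : Pre sig → ℕ
  | bvar _ => 0
  | fvar _ => 0
  | fn _ _ => 0
  | app t u => t.size + u.size + 1
  | lam _ t => t.size + 1

theorem size_openAt_fvar (z : X) (k : ℕ) (t : Pre sig) : (openAt (fvar z) k t).size = t.size := by
  induction t generalizing k with
  | bvar n => simp only [openAt]; split <;> rfl
  | fvar x => rfl
  | fn f ts ih => rfl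
  | app t u iht ihu => simp only [openAt, size, iht, ihu]
  | lam T t ih => simp only [openAt, size, ih]

theorem finite_fv (t : Pre sig) : t.fv.Finite := by
  induction t with
  | bvar n => exact Set.finite_empty
  | fvar x => exact Set.finite_singleton x
  | fn f ts ih => exact Set.finite_iUnion ih
  | app t u iht ihu => exact iht.union ihu
  | lam T t ih => exact ih

theorem fv_openAt_subset (u : Pre sig) (k : ℕ) (t : Pre sig) :
    (openAt u k t).fv ⊆ t.fv ∪ u.fv := by
  induction t generalizing k with
  | bvar n => simp only [openAt]; split <;> simp [fv]
  | fvar x => exact Set.subset_union_left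
  | fn f ts ih =>
    refine Set.iUnion_subset fun i => (ih i k).trans (Set.union_subset_union_left _ ?_)
    exact Set.subset_iUnion (fun i => (ts i).fv) i
  | app t s iht ihs =>
    refine Set.union_subset ((iht k).trans ?_) ((ihs k).trans ?_)
    · exact Set.union_subset_union_left _ Set.subset_union_left
    · exact Set.union_subset_union_left _ Set.subset_union_right
  | lam T t ih => exact ih (k + 1)

theorem fv_subset_openAt (u : Pre sig) (k : ℕ) (t : Pre sig) : t.fv ⊆ (openAt u k t).fv := by
  induction t generalizing k with
  | bvar n => exact Set.empty_subset _
  | fvar x => exact subset_rfl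
  | fn f ts ih => exact Set.iUnion_mono fun i => ih i k
  | app t s iht ihs => exact Set.union_subset_union (iht k) (ihs k)
  | lam T t ih => exact ih (k + 1)

/-- If `z` is not free in the result of replacing the index `k` by `z`, then the index `k` does not
occur, and so may be replaced by anything. -/
theorem openAt_eq_of_notMem_fv {z : X} (w : Pre sig) {k : ℕ} {t : Pre sig}
    (h : z ∉ (openAt (fvar z) k t).fv) : openAt w k t = openAt (fvar z) k t := by
  induction t generalizing k with
  | bvar n =>
    simp only [openAt] at h ⊢
    split at h <;> simp_all [fv]
  | fvar x => rfl
  | fn f ts ih =>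
    simp only [openAt, fv, Set.mem_iUnion, not_exists] at h
    simp only [openAt, fn.injEq, heq_eq_eq, true_and]
    exact funext fun i => ih i (h i)
  | app t s iht ihs =>
    simp only [openAt, fv, Set.mem_union, not_or] at h
    simp only [openAt, iht h.1, ihs h.2]
  | lam T t ih => simp only [openAt, ih (k := k + 1) h]

/-- Simultaneous substitution of terms for the free variables. It is capture-avoiding when the
substituted terms have no dangling index. -/
def subst (σ : X → Pre sig) : Pre sig → Pre sig
  | bvar n => bvar n
  | fvar x => σ x
  | fn f ts => fn f fun i => subst σ (ts i)
  | app t u => app (subst σ t) (subst σ u)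
  | lam T t => lam T (subst σ t)

theorem subst_fvar (t : Pre sig) : t.subst fvar = t := by
  induction t with
  | bvar n => rfl
  | fvar x => rfl
  | fn f ts ih => simp only [subst, ih]
  | app t u iht ihu => simp only [subst, iht, ihu]
  | lam T t ih => simp only [subst, ih]

theorem subst_congr {σ σ' : X → Pre sig} {t : Pre sig} (h : ∀ x ∈ t.fv, σ x = σ' x) :
    t.subst σ = t.subst σ' := by
  induction t with
  | bvar n => rfl
  | fvar x => exact h x rfl
  | fn f ts ih =>
    simp only [subst, fn.injEq, heq_eq_eq, true_and]
    exact funext fun i => ih i fun x hx => h x (Set.mem_iUnion_of_mem i hx)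
  | app t u iht ihu =>
    simp only [subst, iht fun x hx => h x (Or.inl hx), ihu fun x hx => h x (Or.inr hx)]
  | lam T t ih => simp only [subst, ih h]

end Pre

theorem HasType.append {Γ : List (Ty S)} {t : Pre sig} {T : Ty S} (h : HasType Γ t T)
    (Δ : List (Ty S)) : HasType (Γ ++ Δ) t T := by
  induction h with
  | bvar h =>
    refine .bvar ?_
    rw [List.getElem?_append_left (List.getElem?_eq_some_iff.1 h).1, h]
  | fvar x => exact .fvar x
  | fn Ts hf hts ih => exact .fn Ts hf ih
  | app ht hu iht ihu => exact .app iht ihu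
  | lam ht ih => exact .lam ih

theorem HasType.openAt {Γ : List (Ty S)} {t u : Pre sig} {T U : Ty S}
    (ht : HasType (Γ ++ [T]) t U) (hu : OfType u T) : HasType Γ (Pre.openAt u Γ.length t) U := by
  generalize hΔ : Γ ++ [T] = Δ at ht
  induction ht generalizing Γ with
  | @bvar Δ n U h =>
    subst hΔ
    simp only [Pre.openAt]
    split
    · next e =>
      subst e
      simp only [List.getElem?_concat_length, Option.some.injEq] at h
      exact h ▸ hu.append Γ
    · next e =>
      refine .bvar ?_
      have hn := (List.getElem?_eq_some_iff.1 h).1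
      rw [List.length_append, List.length_singleton] at hn
      rwa [List.getElem?_append_left (by omega)] at h
  | fvar x => exact .fvar x
  | fn Ts hf hts ih => exact .fn Ts hf fun i => ih i hΔ
  | app ht hu iht ihu => exact .app (iht hΔ) (ihu hΔ)
  | lam ht ih => exact .lam (ih (Γ := _ :: Γ) (by rw [← hΔ]; rfl))

theorem HasType.inst {t u : Pre sig} {T U : Ty S} (ht : HasType [T] t U) (hu : OfType u T) :
    OfType (t.inst u) U :=
  HasType.openAt (Γ := []) ht hu

theorem HasType.openAt_eq {Γ : List (Ty S)} {t : Pre sig} {T : Ty S} (h : HasType Γ t T)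
    (u : Pre sig) {k : ℕ} (hk : Γ.length ≤ k) : Pre.openAt u k t = t := by
  induction h generalizing k with
  | bvar h =>
    have := (List.getElem?_eq_some_iff.1 h).1
    simp only [Pre.openAt]
    rw [if_neg (by omega)]
  | fvar x => rfl
  | fn Ts hf hts ih => simp only [Pre.openAt, ih _ hk]
  | app ht hu iht ihu => simp only [Pre.openAt, iht hk, ihu hk]
  | lam ht ih => simp only [Pre.openAt, ih (Nat.succ_le_succ hk)]

theorem HasType.subst {Γ : List (Ty S)} {t : Pre sig} {T : Ty S} (h : HasType Γ t T)
    {σ : X → Pre sig} (hσ : ∀ x, OfType (σ x) (sig.varTy x)) : HasType Γ (t.subst σ) T := by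
  induction h with
  | bvar h => exact .bvar h
  | fvar x => exact (hσ x).append _
  | fn Ts hf hts ih => exact .fn Ts hf ih
  | app ht hu iht ihu => exact .app iht ihu
  | lam ht ih => exact .lam ih

theorem subst_openAt {σ : X → Pre sig} (hσ : ∀ x, OfType (σ x) (sig.varTy x)) (u : Pre sig)
    (k : ℕ) (t : Pre sig) :
    (Pre.openAt u k t).subst σ = Pre.openAt (u.subst σ) k (t.subst σ) := by
  induction t generalizing k with
  | bvar n => simp only [Pre.openAt, Pre.subst]; split <;> rfl
  | fvar x => exact ((hσ x).openAt_eq _ (Nat.zero_le k)).symm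
  | fn f ts ih => simp only [Pre.openAt, Pre.subst, ih]
  | app t s iht ihs => simp only [Pre.openAt, Pre.subst, iht, ihs]
  | lam T t ih => simp only [Pre.openAt, Pre.subst, ih]

theorem subst_inst {σ : X → Pre sig} (hσ : ∀ x, OfType (σ x) (sig.varTy x)) (t u : Pre sig) :
    (t.inst u).subst σ = (t.subst σ).inst (u.subst σ) :=
  subst_openAt hσ u 0 t

theorem exists_fresh (V : Ty S) (t : Pre sig) (Y : Finset X) (u : Pre sig) :
    ∃ z, sig.varTy z = V ∧ Fresh z t Y u := by
  obtain ⟨z, hz, h⟩ := (sig.varTy_infinite V).exists_notMem_finset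
    ((t.finite_fv.union (Y.finite_toSet.union u.finite_fv)).toFinset)
  simp only [Set.Finite.mem_toFinset, Set.mem_union, Finset.mem_coe, not_or] at h
  exact ⟨z, hz, h⟩

open Classical in
/-- Redirecting a substitution from the fresh variable `z` to `w` commutes with instantiation. -/
theorem inst_subst_update {σ : X → Pre sig} {z : X} {w t : Pre sig}
    (hσ : ∀ x, OfType (Function.update σ z w x) (sig.varTy x)) (hz : z ∉ t.fv) :
    (t.inst (.fvar z)).subst (Function.update σ z w) = (t.subst σ).inst w := by
  rw [subst_inst hσ, Pre.subst, Function.update_self,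
    Pre.subst_congr (σ' := σ) fun x hx =>
      Function.update_of_ne (ne_of_mem_of_not_mem hx hz) _ _]

open Classical in
theorem subst_update_of_notMem {σ : X → Pre sig} {z : X} {w t : Pre sig} (hz : z ∉ t.fv) :
    t.subst (Function.update σ z w) = t.subst σ :=
  Pre.subst_congr fun _ hx => Function.update_of_ne (ne_of_mem_of_not_mem hx hz) _ _

open Classical in
theorem ofType_update {σ : X → Pre sig} (hσ : ∀ x, OfType (σ x) (sig.varTy x)) {z : X}
    {w : Pre sig} (hw : OfType w (sig.varTy z)) (x : X) :
    OfType (Function.update σ z w x) (sig.varTy x) := by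
  rcases eq_or_ne x z with rfl | h
  · rwa [Function.update_self]
  · rw [Function.update_of_ne h]; exact hσ x

/-! ### Free variables and stability under substitution of the ordering -/

variable {O : TypeOrder S} {P : Precedence F}

theorem gt_iff_step {Y : Finset X} {t u : Pre sig} :
    Gt O P Y t u ↔ Step O P (Gt O P) Y t u := by
  have h : Step O P (Gt O P) = Gt (sig := sig) O P :=
    OrderHom.map_lfp ⟨Step (sig := sig) O P, Step.mono O P⟩
  rw [h]

theorem Gt.induct {R : Finset X → Pre sig → Pre sig → Prop}
    (h : ∀ Y t u, Step O P R Y t u → R Y t u) {Y : Finset X} {t u : Pre sig}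
    (htu : Gt O P Y t u) : R Y t u :=
  OrderHom.lfp_le ⟨Step (sig := sig) O P, Step.mono O P⟩ h Y t u htu

theorem Gt.fv_subset {Y : Finset X} {t u : Pre sig} (h : Gt O P Y t u) : u.fv ⊆ t.fv ∪ Y := by
  classical
  refine Gt.induct (R := fun Y t u => u.fv ⊆ t.fv ∪ Y) ?_ h
  -- The reflexive closures occurring in the premises of the rules.
  have refl_case : ∀ {Y : Finset X} {t u : Pre sig} {R : Pre sig → Pre sig → Prop},
      (∀ a b, R a b → b.fv ⊆ a.fv ∪ Y) → Refl R t u → u.fv ⊆ t.fv ∪ Y := by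
    rintro Y t u R hR (rfl | h)
    · exact Set.subset_union_left
    · exact hR _ _ h
  have open_sub : ∀ {v : Pre sig} {z : X} {A : Set X}, z ∉ v.fv →
      (v.inst (.fvar z)).fv ⊆ insert z A → v.fv ⊆ A := by
    intro v z A hz h x hx
    exact (h (Pre.fv_subset_openAt _ 0 v hx)).resolve_left (ne_of_mem_of_not_mem hx hz)
  intro Y t u h
  cases h with
  | @big_sub f ts _ i h =>
    have := refl_case (fun _ _ h => h.1) h
    rw [Finset.coe_empty, Set.union_empty] at this
    exact (this.trans (Set.subset_iUnion (fun i => (ts i).fv) i)).trans Set.subset_union_left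
  | big_eq hfg h hs => exact Set.iUnion_subset h
  | big_gt hfg h => exact Set.iUnion_subset h
  | big_app hu hv => exact Set.union_subset hu hv
  | @big_lam f ts V v z hz hfr h =>
    refine open_sub (v := v) (z := z) hfr.2.2 (h.trans ?_)
    rw [Finset.coe_insert, Set.union_insert]
  | big_var hy => exact Set.singleton_subset_iff.2 (Or.inr hy)
  | app_sub h =>
    rcases h with h | h
    · exact (refl_case (fun _ _ h => h) h).trans
        (Set.union_subset_union_left _ Set.subset_union_left)
    · exact (refl_case (fun _ _ h => h.1) h).trans
        (Set.union_subset_union_left _ Set.subset_union_right)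
  | @app_eq t u t' u' h =>
    rcases h with ⟨rfl, h⟩ | ⟨ht, hu⟩
    · refine Set.union_subset ?_ (h.trans (Set.union_subset_union_left _ Set.subset_union_right))
      exact Set.subset_union_left.trans Set.subset_union_left
    · have aux : ∀ v, AppGt O (fun t u : Pre sig => u.fv ⊆ t.fv ∪ Y) t u v →
          v.fv ⊆ (t.fv ∪ u.fv) ∪ Y := by
        rintro v (h | h | h)
        · exact h.1.trans (Set.union_subset_union_left _ Set.subset_union_left)
        · exact (refl_case (fun _ _ h => h.1) h).trans
            (Set.union_subset_union_left _ Set.subset_union_right)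
        · exact h.1
      exact Set.union_subset (aux _ ht) (aux _ hu)
  | @app_lam t u V v z hz hfr h => exact (Pre.fv_subset_openAt _ 0 v).trans h
  | app_var hy => exact Set.singleton_subset_iff.2 (Or.inr hy)
  | app_beta h =>
    exact (refl_case (fun _ _ h => h) h).trans
      (Set.union_subset_union_left _ (Pre.fv_openAt_subset _ 0 _))
  | @lam_sub T t v z hz hfr h =>
    have h' := (refl_case (fun _ _ h => h.1) h).trans
      (Set.union_subset_union_left _ (Pre.fv_openAt_subset _ 0 _))
    intro x hx
    rcases h' hx with (h | h) | h
    · exact Or.inl h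
    · exact absurd hx (h ▸ hfr.2.2)
    · exact Or.inr h
  | @lam_eq T t v z hz hfr h =>
    have h' := h.trans (Set.union_subset_union_left _ (Pre.fv_openAt_subset _ 0 _))
    intro x hx
    rcases h' (Pre.fv_subset_openAt _ 0 _ hx) with (h | h) | h
    · exact Or.inl h
    · exact absurd hx (h ▸ hfr.2.2)
    · exact Or.inr h
  | @lam_neq T t V v hTV z hz hfr h => exact (Pre.fv_subset_openAt _ 0 v).trans h
  | lam_var hy => exact Set.singleton_subset_iff.2 (Or.inr hy)
  | lam_eta ht h =>
    exact (refl_case (fun _ _ h => h) h).trans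
      (Set.union_subset_union_left _ Set.subset_union_left)

theorem Typed.map {R R' : Pre sig → Pre sig → Prop} {σ : X → Pre sig} {a b : Pre sig}
    (hab : Typed O R a b) (hσ : ∀ x, OfType (σ x) (sig.varTy x))
    (h : ∀ a b, R a b → R' (a.subst σ) (b.subst σ)) : Typed O R' (a.subst σ) (b.subst σ) := by
  obtain ⟨h₁, T, U, ha, hb, hTU⟩ := hab
  exact ⟨h _ _ h₁, T, U, HasType.subst ha hσ, HasType.subst hb hσ, hTU⟩

theorem Refl.map {α : Type u} {R R' : α → α → Prop} {f : α → α} {a b : α}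
    (hab : Refl R a b) (h : ∀ a b, R a b → R' (f a) (f b)) : Refl R' (f a) (f b) :=
  hab.imp (congrArg f) (h _ _)

theorem AppGt.map {R R' : Pre sig → Pre sig → Prop} {σ : X → Pre sig} {t u v : Pre sig}
    (htuv : AppGt O R t u v) (hσ : ∀ x, OfType (σ x) (sig.varTy x))
    (h : ∀ a b, R a b → R' (a.subst σ) (b.subst σ)) :
    AppGt O R' (t.subst σ) (u.subst σ) (v.subst σ) :=
  htuv.imp (fun h₁ => h₁.map hσ h)
    (Or.imp (fun h₁ => h₁.map fun _ _ h₂ => h₂.map hσ h) (fun h₁ => h₁.map hσ h))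

theorem StatusExt.map {α : Type u} {R R' : α → α → Prop} {f : α → α} {s : Status}
    {ts us : List α} (hs : StatusExt R s ts us) (h : ∀ a b, R a b → R' (f a) (f b)) :
    StatusExt R' s (ts.map f) (us.map f) := by
  cases s with
  | mul =>
    have hm : ∀ M N : Multiset α, MulStep R M N → MulStep R' (M.map f) (N.map f) := by
      rintro M N ⟨K, a, Y, rfl, rfl, hY⟩
      refine ⟨K.map f, f a, Y.map f, by simp, by simp, fun b hb => ?_⟩
      obtain ⟨c, hc, rfl⟩ := Multiset.mem_map.1 hb
      exact h _ _ (hY c hc)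
    exact Relation.TransGen.lift (Multiset.map f) hm _ _ hs
  | lex n hn =>
    obtain ⟨j, ht, hu, hj, hR, he⟩ := hs
    refine ⟨j, by simpa using ht, by simpa using hu, hj, ?_, ?_⟩
    · simpa only [List.getElem_map] using h _ _ hR
    · rw [← List.map_take, ← List.map_take, he]

/-- Stability under substitution. The substitution may rename the variables of `Y`: this freedom is
what allows the fresh variables of a derivation to be changed into variables that are also fresh for
the substituted terms. -/
theorem Gt.subst {Y : Finset X} {t u : Pre sig} (h : Gt O P Y t u) {σ : X → Pre sig}
    (hσ : ∀ x, OfType (σ x) (sig.varTy x)) {Y' : Finset X}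
    (hY : ∀ y ∈ Y, ∃ y' ∈ Y', σ y = .fvar y') : Gt O P Y' (t.subst σ) (u.subst σ) := by
  classical
  refine Gt.induct (R := fun Y t u => ∀ (σ : X → Pre sig) (Y' : Finset X),
    (∀ x, OfType (σ x) (sig.varTy x)) → (∀ y ∈ Y, ∃ y' ∈ Y', σ y = .fvar y') →
      Gt O P Y' (t.subst σ) (u.subst σ)) ?_ h σ Y' hσ hY
  clear h hσ hY
  intro Y t u h σ Y' hσ hY
  -- A substitution extended at the fresh variable `z` by a new fresh variable `z'`.
  have ext : ∀ {z z' : X}, sig.varTy z' = sig.varTy z →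
      ∀ x, OfType (Function.update σ z (.fvar z') x) (sig.varTy x) := by
    intro z z' e
    exact ofType_update hσ (e ▸ .fvar z')
  have extY : ∀ {z : X} (w : Pre sig), z ∉ Y →
      ∀ y ∈ Y, ∃ y' ∈ Y', Function.update σ z w y = .fvar y' := by
    intro z w hz y hy
    rw [Function.update_of_ne (ne_of_mem_of_not_mem hy hz)]
    exact hY y hy
  have hE : ∀ y ∈ (∅ : Finset X), ∃ y' ∈ (∅ : Finset X), σ y = .fvar y' := by simp
  have var_case : ∀ {y : X} {t : Pre sig}, y ∈ Y →
      (∀ y' ∈ Y', Step O P (Gt O P) Y' t (.fvar y')) → Gt O P Y' t (σ y) := by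
    intro y t hy ht
    obtain ⟨y', hy', e⟩ := hY y hy
    rw [e]
    exact gt_iff_step.2 (ht y' hy')
  cases h with
  | big_sub i h =>
    exact gt_iff_step.2 (.big_sub i (h.map fun _ _ h => h.map hσ fun _ _ h => h σ ∅ hσ hE))
  | big_eq hfg h hs =>
    refine gt_iff_step.2 (.big_eq hfg (fun i => h i σ Y' hσ hY) ?_)
    have := hs.map fun _ _ h => h.map hσ fun _ _ h => h σ ∅ hσ hE
    rwa [List.map_ofFn, List.map_ofFn] at this
  | big_gt hfg h => exact gt_iff_step.2 (.big_gt hfg fun i => h i σ Y' hσ hY)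
  | big_app hu hv => exact gt_iff_step.2 (.big_app (hu σ Y' hσ hY) (hv σ Y' hσ hY))
  | @big_lam f ts V v z hz hfr h =>
    obtain ⟨z', hz', hfr'⟩ :=
      exists_fresh V ((Pre.fn f ts).subst σ) Y' ((Pre.lam V v).subst σ)
    have := h (Function.update σ z (.fvar z')) (insert z' Y') (ext (hz'.trans hz.symm)) (by
      intro y hy
      rcases Finset.mem_insert.1 hy with rfl | hy
      · exact ⟨z', Finset.mem_insert_self _ _, Function.update_self _ _ _⟩
      · obtain ⟨y', hy', e⟩ := extY (.fvar z') hfr.2.1 y hy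
        exact ⟨y', Finset.mem_insert_of_mem hy', e⟩)
    rw [inst_subst_update (t := v) (ext (hz'.trans hz.symm)) hfr.2.2,
      subst_update_of_notMem hfr.1] at this
    exact gt_iff_step.2 (.big_lam z' hz' hfr' this)
  | big_var hy => exact var_case hy fun y' hy' => .big_var hy'
  | app_sub h =>
    refine gt_iff_step.2 (.app_sub (h.imp ?_ ?_))
    · exact fun h => h.map fun _ _ h => h σ Y' hσ hY
    · exact fun h => h.map fun _ _ h => h.map hσ fun _ _ h => h σ Y' hσ hY
  | app_eq h =>
    refine gt_iff_step.2 (.app_eq (h.imp ?_ ?_))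
    · exact fun ⟨e, h⟩ => ⟨congrArg _ e, h σ Y' hσ hY⟩
    · exact And.imp (fun h => h.map hσ fun _ _ h => h σ Y' hσ hY)
        (fun h => h.map hσ fun _ _ h => h σ Y' hσ hY)
  | @app_lam t u V v z hz hfr h =>
    obtain ⟨z', hz', hfr'⟩ := exists_fresh V ((Pre.app t u).subst σ) Y' ((Pre.lam V v).subst σ)
    have := h (Function.update σ z (.fvar z')) Y' (ext (hz'.trans hz.symm)) (extY _ hfr.2.1)
    rw [inst_subst_update (t := v) (ext (hz'.trans hz.symm)) hfr.2.2,
      subst_update_of_notMem hfr.1] at this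
    exact gt_iff_step.2 (.app_lam z' hz' hfr' this)
  | app_var hy => exact var_case hy fun y' hy' => .app_var hy'
  | app_beta h =>
    have := h.map (f := Pre.subst σ) fun _ _ h => h σ Y' hσ hY
    rw [subst_inst hσ] at this
    exact gt_iff_step.2 (.app_beta this)
  | @lam_sub T t v z hz hfr h =>
    obtain ⟨z', hz', hfr'⟩ := exists_fresh T ((Pre.lam T t).subst σ) Y' (u.subst σ)
    have hσ' := ext (hz'.trans hz.symm)
    have := h.map (f := Pre.subst _) fun _ _ h => h.map hσ' fun _ _ h =>
      h (Function.update σ z (.fvar z')) Y' hσ' (extY _ hfr.2.1)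
    rw [inst_subst_update (t := t) hσ' hfr.1, subst_update_of_notMem hfr.2.2] at this
    exact gt_iff_step.2 (.lam_sub z' hz' hfr' this)
  | @lam_eq T t v z hz hfr h =>
    obtain ⟨z', hz', hfr'⟩ := exists_fresh T ((Pre.lam T t).subst σ) Y' ((Pre.lam T v).subst σ)
    have hσ' := ext (hz'.trans hz.symm)
    have := h (Function.update σ z (.fvar z')) Y' hσ' (extY _ hfr.2.1)
    rw [inst_subst_update (t := t) hσ' hfr.1, inst_subst_update (t := v) hσ' hfr.2.2] at this
    exact gt_iff_step.2 (.lam_eq z' hz' hfr' this)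
  | @lam_neq T t V v hTV z hz hfr h =>
    obtain ⟨z', hz', hfr'⟩ := exists_fresh V ((Pre.lam T t).subst σ) Y' ((Pre.lam V v).subst σ)
    have := h (Function.update σ z (.fvar z')) Y' (ext (hz'.trans hz.symm)) (extY _ hfr.2.1)
    rw [inst_subst_update (t := v) (ext (hz'.trans hz.symm)) hfr.2.2,
      subst_update_of_notMem hfr.1] at this
    exact gt_iff_step.2 (.lam_neq hTV z' hz' hfr' this)
  | lam_var hy => exact var_case hy fun y' hy' => .lam_var hy'
  | lam_eta ht h =>
    exact gt_iff_step.2 (.lam_eta (HasType.subst ht hσ) (h.map fun _ _ h => h σ Y' hσ hY))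

/-- A comparison of bodies at one fresh variable holds at every instance. -/
theorem Gt.inst {t v w : Pre sig} {z : X} (h : Gt O P ∅ (t.inst (.fvar z)) (v.inst (.fvar z)))
    (ht : z ∉ t.fv) (hv : z ∉ v.fv) (hw : OfType w (sig.varTy z)) :
    Gt O P ∅ (t.inst w) (v.inst w) := by
  classical
  have hσ := ofType_update (fun x => HasType.fvar (sig := sig) x) hw
  have := h.subst hσ (Y' := ∅) (by simp)
  rwa [inst_subst_update hσ ht, inst_subst_update hσ hv, Pre.subst_fvar, Pre.subst_fvar] at this

/-- If `t >^∅ v[z/y]` with `z` not free in `t`, then `y` does not occur in `v`. -/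
theorem Gt.inst_eq {t v : Pre sig} {z : X} (h : Gt O P ∅ t (v.inst (.fvar z))) (ht : z ∉ t.fv)
    (w : Pre sig) : v.inst w = v.inst (.fvar z) :=
  Pre.openAt_eq_of_notMem_fv w fun hz => (h.fv_subset hz).elim ht (by simp)

/-! ### Types -/

theorem TypeOrder.ge.trans {T U V : Ty S} (h : O.ge T U) (h' : O.ge U V) : O.ge T V := by
  rcases h with rfl | h
  · exact h'
  rcases h' with rfl | h'
  · exact Or.inr h
  · exact Or.inr (O.trans _ _ _ h h')

theorem TypeOrder.gt_right (U V : Ty S) : O.gt (U ⇒ V) V := O.right_subterm _ _ ⟨U, rfl⟩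

theorem TypeOrder.gt_of_gt_of_ge {T U V : Ty S} (h : O.gt T U) (h' : O.ge U V) : O.gt T V := by
  rcases h' with rfl | h'
  · exact h
  · exact O.trans _ _ _ h h'

theorem TypeOrder.not_ge_arrow (U V : Ty S) : ¬ O.ge V (U ⇒ V) := fun h =>
  O.irrefl _ (TypeOrder.gt_of_gt_of_ge (TypeOrder.gt_right U V) h)

theorem TypeOrder.ge_arrow_cases {U V W : Ty S} (h : O.ge (U ⇒ V) W) :
    O.ge V W ∨ ∃ V', W = U ⇒ V' ∧ O.ge V V' := by
  rcases h with rfl | h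
  · exact Or.inr ⟨V, rfl, Or.inl rfl⟩
  · rcases O.of_arrow _ _ _ h with h | ⟨V', e, h⟩
    · exact Or.inl h
    · exact Or.inr ⟨V', e, Or.inr h⟩

theorem TypeOrder.ge_of_arrow_ge_arrow {U V V' : Ty S} (h : O.ge (U ⇒ V) (U ⇒ V')) :
    O.ge V V' := by
  rcases TypeOrder.ge_arrow_cases h with h | ⟨W, e, h⟩
  · exact h.trans (Or.inr (TypeOrder.gt_right U V'))
  · rwa [(Ty.arrow.inj e).2]

theorem WfGt.left (U V : Ty S) : WfGt O.gt (U ⇒ V) U := .single (Or.inr ⟨V, rfl⟩)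

theorem WfGt.right (U V : Ty S) : WfGt O.gt (U ⇒ V) V :=
  .single (Or.inl (TypeOrder.gt_right U V))

theorem OfType.app_inv {t u : Pre sig} {V : Ty S} (h : OfType (.app t u) V) :
    ∃ U, OfType t (U ⇒ V) ∧ OfType u U := by
  cases h with | app ht hu => exact ⟨_, ht, hu⟩

theorem OfType.lam_inv {t : Pre sig} {U T : Ty S} (h : OfType (.lam U t) T) :
    ∃ V, T = U ⇒ V ∧ HasType [U] t V := by
  cases h with | lam ht => exact ⟨_, rfl, ht⟩

/-! ### Reducts and strong normalization -/

theorem Core.of_gt {t u : Pre sig} {T U : Ty S} (h : Gt O P ∅ t u) (ht : OfType t T)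
    (hu : OfType u U) (hTU : O.ge T U) : Core O P t u :=
  ⟨h, T, U, ht, hu, hTU⟩

theorem not_core_fvar {x : X} {v : Pre sig} : ¬ Core O P (.fvar x) v := fun h => by
  cases gt_iff_step.1 h.1

theorem Core.app_of_ge {t t' u : Pre sig} {U V T' : Ty S} (h : Core O P t t')
    (ht : OfType t (U ⇒ V)) (hu : OfType u U) (ht' : OfType t' T') (hV : O.ge V T') :
    Core O P (.app t u) t' :=
  .of_gt (gt_iff_step.2 (.app_sub (Or.inl (Or.inr h.1)))) (.app ht hu) ht' hV

theorem Core.app_of_arrow {t t' u : Pre sig} {U V V' : Ty S} (h : Core O P t t')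
    (ht : OfType t (U ⇒ V)) (hu : OfType u U) (ht' : OfType t' (U ⇒ V')) :
    Core O P (.app t u) (.app t' u) :=
  .of_gt (gt_iff_step.2 (.app_eq (Or.inr ⟨Or.inl h, Or.inr (Or.inl (Or.inl rfl))⟩)))
    (.app ht hu) (.app ht' hu) (TypeOrder.ge_of_arrow_ge_arrow (h.type_ge ht ht'))

theorem mem_SN_iff {t : Pre sig} {T : Ty S} (ht : OfType t T) :
    t ∈ SN (Core O P) ↔ Acc (Function.swap (Core O P)) t := by
  rw [acc_iff_isEmpty_descending_chain, isEmpty_subtype]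
  exact ⟨fun h s hs => h.2 ⟨s, hs⟩, fun h => ⟨⟨T, ht⟩, fun ⟨s, hs⟩ => h s hs⟩⟩

/-- An infinite sequence of reducts of `t` yields one of reducts of `t u`: the application to `u` is
kept as long as the type of the reduct still has domain `U`. -/
theorem acc_of_acc_app {t u : Pre sig} {U V : Ty S} (ht : OfType t (U ⇒ V)) (hu : OfType u U)
    (h : Acc (Function.swap (Core O P)) (.app t u)) : Acc (Function.swap (Core O P)) t := by
  generalize e : Pre.app t u = s at h
  induction h generalizing t V with
  | intro s h ih =>
    subst e
    refine ⟨_, fun t' htt' => ?_⟩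
    obtain ⟨-, -, T', -, ht', -⟩ := id htt'
    have hstep : Core O P t t' := htt'
    rcases TypeOrder.ge_arrow_cases (hstep.type_ge ht ht') with hV | ⟨V', rfl, -⟩
    · exact h _ (hstep.app_of_ge ht hu ht' hV)
    · exact ih _ (hstep.app_of_arrow ht hu ht') ht' rfl

/-! ### Computability at arrow types -/

section Arrow

variable {I : S → Set (Pre sig)}

theorem Computable.mem {t : Pre sig} {T : Ty S} (h : Computable I t) (ht : OfType t T) :
    t ∈ interp I T := by
  obtain ⟨U, hU, h⟩ := h
  rwa [HasType.unique ht hU]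

/-- The interpretation of `T` is a computability predicate with respect to core CPO. -/
abbrev IsComp (O : TypeOrder S) (P : Precedence F) (I : S → Set (Pre sig)) (T : Ty S) : Prop :=
  IsCompPred (Core O P) {t | Neutral t} I T (interp I T)

theorem IsComp.computable {t : Pre sig} {T : Ty S} (hT : IsComp O P I T) (h : t ∈ interp I T) :
    Computable I t :=
  ⟨T, hT.typed t h, h⟩

theorem IsComp.acc {t : Pre sig} {T : Ty S} (hT : IsComp O P I T) (h : t ∈ interp I T) :
    Acc (Function.swap (Core O P)) t :=
  (mem_SN_iff (hT.typed t h)).1 (hT.comp_sn h)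

theorem IsComp.of_refl {t v : Pre sig} {T : Ty S} (hT : IsComp O P I T) (h : t ∈ interp I T)
    (htv : Refl (Core O P) t v) : Computable I v := by
  rcases htv with rfl | htv
  · exact hT.computable h
  · exact hT.comp_red t h v htv

theorem IsComp.exists_fvar_mem {T : Ty S} (hT : IsComp O P I T) :
    ∃ x : X, OfType (sig := sig) (.fvar x) T ∧ .fvar x ∈ interp I T := by
  obtain ⟨x, rfl⟩ := (sig.varTy_infinite T).nonempty
  exact ⟨x, .fvar x, hT.comp_neutral _ (.fvar x) (.var x) fun u hu => (not_core_fvar hu).elim⟩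

variable {U V : Ty S}

theorem arrow_comp_sn (hU : IsComp O P I U) (hV : IsComp O P I V) :
    interp I (U ⇒ V) ⊆ SN (Core O P) := by
  rintro t ⟨ht, h⟩
  obtain ⟨x, hx, hxU⟩ := hU.exists_fvar_mem
  exact (mem_SN_iff ht).2 (acc_of_acc_app ht hx (hV.acc (h _ hxU)))

theorem arrow_comp_red (hU : IsComp O P I U) (hV : IsComp O P I V) {t t' : Pre sig}
    (ht : t ∈ interp I (U ⇒ V)) (htt' : Core O P t t') : Computable I t' := by
  obtain ⟨-, -, T', -, ht', -⟩ := id htt'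
  rcases TypeOrder.ge_arrow_cases (htt'.type_ge ht.1 ht') with hVT | ⟨V', rfl, -⟩
  · obtain ⟨x, hx, hxU⟩ := hU.exists_fvar_mem
    exact hV.comp_red _ (ht.2 _ hxU) _ (htt'.app_of_ge ht.1 hx ht' hVT)
  · refine ⟨_, ht', ht', fun u hu => ?_⟩
    have hu' := hU.typed u hu
    exact (hV.comp_red _ (ht.2 u hu) _ (htt'.app_of_arrow ht.1 hu' ht')).mem (.app ht' hu')

/-- If `t > v[z/y]` with `z` not free in `t`, then all instances of `v` are equal, and `λy v` is
computable as soon as `v[z/y]` is. -/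
theorem IsComp.lam_of_gt {t v : Pre sig} {W : Ty S} {z : X} (hW : IsComp O P I W)
    (hv : OfType (.lam V v) W) (h : Gt O P ∅ t (v.inst (.fvar z))) (hz : z ∉ t.fv)
    (hc : Computable I (v.inst (.fvar z))) : Computable I (.lam V v) := by
  obtain ⟨W', rfl, -⟩ := hv.lam_inv
  refine hW.computable (hW.comp_lam _ _ v rfl hv fun w _ => ?_)
  rwa [h.inst_eq hz w]

/-- A term of type `U ⇒ V` is computable if its reducts are, if its applications are neutral and if,
when it is an abstraction, its instances are computable. -/
theorem mem_interp_arrow (ih : ∀ W, WfGt O.gt (U ⇒ V) W → IsComp O P I W) {t : Pre sig}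
    (ht : OfType t (U ⇒ V)) (hred : ∀ v, Core O P t v → Computable I v)
    (hneutral : ∀ u, Neutral (.app t u))
    (hbeta : ∀ T s, t = .lam T s → ∀ u ∈ interp I U, Computable I (s.inst u)) :
    t ∈ interp I (U ⇒ V) := by
  have hU := ih U (.left U V)
  have hV := ih V (.right U V)
  refine ⟨ht, fun u hu => ?_⟩
  have hacc := hU.acc hu
  induction hacc with
  | intro u _ ihu =>
  have hu' := hU.typed u hu
  have htu : OfType (.app t u) V := .app ht hu'
  refine hV.comp_neutral _ htu (hneutral u) fun v hv => ?_
  generalize hn : v.size = n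
  induction n using Nat.strong_induction_on generalizing v with
  | _ n ihv =>
  obtain ⟨-, -, W, -, hvW, -⟩ := id hv
  have hVW := hv.type_ge htu hvW
  cases gt_iff_step.1 hv.1 with
  | app_sub h =>
    rcases h with (rfl | h) | h
    · rw [HasType.unique hvW ht] at hVW
      exact absurd hVW (TypeOrder.not_ge_arrow U V)
    · exact hred v (.of_gt h ht hvW
        (Or.inr (TypeOrder.gt_of_gt_of_ge (TypeOrder.gt_right U V) hVW)))
    · exact hU.of_refl hu h
  | @app_eq _ _ t' u' h =>
    obtain ⟨U', ht', hu''⟩ := hvW.app_inv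
    rcases h with ⟨rfl, h⟩ | ⟨h₁, h₂⟩
    · obtain ⟨rfl, rfl⟩ := Ty.arrow.inj (HasType.unique ht' ht)
      have huu' : Core O P u u' := .of_gt h hu' hu'' (Or.inl rfl)
      exact ⟨_, hvW, ihu u' huu' ((hU.comp_red u hu u' huu').mem hu'')⟩
    · have aux : ∀ s, s.size < n → AppGt O (Gt O P ∅) t u s → Computable I s := by
        rintro s hs (h | h | h)
        · exact hred s h
        · exact hU.of_refl hu h
        · exact ihv _ hs s h rfl
      simp only [Pre.size] at hn
      have h₁' := (aux t' (by omega) h₁).mem ht'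
      have h₂' := (aux u' (by omega) h₂).mem hu''
      exact ⟨_, hvW, h₁'.2 u' h₂'⟩
  | @app_lam _ _ T' v z hz hfr h =>
    obtain ⟨W', rfl, hv'⟩ := hvW.lam_inv
    have hvz : OfType (v.inst (.fvar z)) W' := hv'.inst (hz ▸ .fvar z)
    have hW : IsComp O P I (T' ⇒ W') :=
      ih _ (.single (Or.inl (TypeOrder.gt_of_gt_of_ge (TypeOrder.gt_right U V) hVW)))
    refine hW.lam_of_gt hvW h hfr.1 (ihv v.size ?_ _ (.of_gt h htu hvz
      (hVW.trans (Or.inr (TypeOrder.gt_right T' W')))) (Pre.size_openAt_fvar z 0 v))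
    simp only [Pre.size] at hn
    omega
  | app_var hy => simp at hy
  | @app_beta T s _ _ h =>
    obtain ⟨V', e, hs⟩ := ht.lam_inv
    obtain ⟨rfl, rfl⟩ := Ty.arrow.inj e
    have hsu : OfType (s.inst u) V := hs.inst hu'
    exact hV.of_refl ((hbeta U s rfl u hu).mem hsu) (h.imp_right fun h => .of_gt h hsu hvW hVW)

theorem arrow_comp_neutral (ih : ∀ W, WfGt O.gt (U ⇒ V) W → IsComp O P I W) {t : Pre sig}
    (ht : OfType t (U ⇒ V)) (hn : Neutral t) (hred : ∀ v, Core O P t v → Computable I v) :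
    t ∈ interp I (U ⇒ V) := by
  refine mem_interp_arrow ih ht hred (fun u => .app t u hn) ?_
  rintro T s rfl
  cases hn

/-- The reducts of an abstraction with computable instances are computable, provided that those
which are abstractions of the same type with computable instances are. -/
theorem Core.computable_of_lam (ih : ∀ W, WfGt O.gt (U ⇒ V) W → IsComp O P I W) {t : Pre sig}
    (ht : HasType [U] t V) (hinst : ∀ u ∈ interp I U, Computable I (t.inst u))
    (hlam : ∀ v, HasType [U] v V → (∀ w, OfType w U → Core O P (t.inst w) (v.inst w)) →
      .lam U v ∈ interp I (U ⇒ V))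
    {v : Pre sig} (hv : Core O P (.lam U t) v) : Computable I v := by
  have hU := ih U (.left U V)
  have hV := ih V (.right U V)
  have htT : OfType (.lam U t) (U ⇒ V) := .lam ht
  generalize hn : v.size = n
  induction n using Nat.strong_induction_on generalizing v with
  | _ n ihv =>
  obtain ⟨-, -, W, -, hvW, -⟩ := id hv
  have hTW := hv.type_ge htT hvW
  cases gt_iff_step.1 hv.1 with
  | lam_sub z hz hfr h =>
    have htz := ht.inst (u := .fvar z) (hz ▸ .fvar z)
    have hzU : .fvar z ∈ interp I U :=
      hU.comp_neutral _ (hz ▸ .fvar z) (.var z) fun u hu => (not_core_fvar hu).elim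
    exact hV.of_refl ((hinst _ hzU).mem htz) h
  | @lam_eq _ _ v z hz hfr h =>
    obtain ⟨V', rfl, hv'⟩ := hvW.lam_inv
    have hVV' := TypeOrder.ge_of_arrow_ge_arrow hTW
    have hstep : ∀ w, OfType w U → Core O P (t.inst w) (v.inst w) := fun w hw =>
      .of_gt (h.inst hfr.1 hfr.2.2 (hz ▸ hw)) (ht.inst hw) (hv'.inst hw) hVV'
    rcases hTW with e | hgt
    · obtain ⟨-, rfl⟩ := Ty.arrow.inj e
      exact ⟨_, hvW, hlam v hv' hstep⟩
    · have hW := ih _ (.single (Or.inl hgt))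
      refine hW.computable (hW.comp_lam _ _ v rfl hvW fun w hw => ?_)
      have hw' := hU.typed w hw
      exact hV.comp_red _ ((hinst w hw).mem (ht.inst hw')) _ (hstep w hw')
  | @lam_neq _ _ V₁ v hUV z hz hfr h =>
    obtain ⟨W', rfl, hv'⟩ := hvW.lam_inv
    have hvz : OfType (v.inst (.fvar z)) W' := hv'.inst (hz ▸ .fvar z)
    have hgt : O.gt (U ⇒ V) (V₁ ⇒ W') :=
      hTW.resolve_left fun e => hUV (Ty.arrow.inj e).1
    refine (ih _ (.single (Or.inl hgt))).lam_of_gt hvW h hfr.1 (ihv v.size ?_ (.of_gt h htT hvz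
      (hTW.trans (Or.inr (TypeOrder.gt_right V₁ W')))) (Pre.size_openAt_fvar z 0 v))
    simp only [Pre.size] at hn
    omega
  | lam_var hy => simp at hy
  | @lam_eta _ s _ V' hs h =>
    -- Here `t = s x` with `x` not free in `s`, so that the instances of `t` are the `s u`.
    have hinst_eq : ∀ u, (Pre.app s (.bvar 0)).inst u = .app s u := fun u => by
      have := HasType.openAt_eq hs u (k := 0) le_rfl
      simp only [Pre.inst, Pre.openAt, this, if_true]
    obtain rfl : V' = V := by
      obtain ⟨x, hx, -⟩ := hU.exists_fvar_mem
      have := ht.inst hx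
      rw [hinst_eq] at this
      exact HasType.unique (.app hs hx) this
    have hs' : s ∈ interp I (U ⇒ V') := by
      refine ⟨hs, fun u hu => ?_⟩
      rw [← hinst_eq]
      exact (hinst u hu).mem (ht.inst (hU.typed u hu))
    rcases h with rfl | h
    · exact ⟨_, hs, hs'⟩
    · exact arrow_comp_red hU hV hs' (.of_gt h hs hvW hTW)

theorem arrow_comp_lam (ih : ∀ W, WfGt O.gt (U ⇒ V) W → IsComp O P I W) {t : Pre sig}
    (ht : HasType [U] t V) (hinst : ∀ u ∈ interp I U, Computable I (t.inst u)) :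
    .lam U t ∈ interp I (U ⇒ V) := by
  have hU := ih U (.left U V)
  have hV := ih V (.right U V)
  -- The induction is on the instance of the body by a variable chosen once and for all, since
  -- reducing under the abstraction reduces all instances.
  obtain ⟨x, hx, hxU⟩ := hU.exists_fvar_mem
  have hacc := hV.acc ((hinst _ hxU).mem (ht.inst hx))
  generalize e : t.inst (.fvar x) = s at hacc
  induction hacc generalizing t with
  | intro s _ ihs =>
    subst e
    refine mem_interp_arrow ih (.lam ht) (fun v hv => Core.computable_of_lam ih ht hinst ?_ hv)
      (fun u => .beta U t u) ?_
    · intro v hv hstep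
      refine ihs _ (hstep _ hx) hv (fun u hu => ?_) rfl
      have hu' := hU.typed u hu
      exact hV.comp_red _ ((hinst u hu).mem (ht.inst hu')) _ (hstep u hu')
    · intro T s e
      obtain ⟨-, rfl⟩ := Pre.lam.inj e
      exact hinst

theorem isComp_arrow (ih : ∀ W, WfGt O.gt (U ⇒ V) W → IsComp O P I W) :
    IsComp O P I (U ⇒ V) where
  typed t ht := ht.1
  comp_sn := arrow_comp_sn (ih U (.left U V)) (ih V (.right U V))
  comp_red t ht u hu := arrow_comp_red (ih U (.left U V)) (ih V (.right U V)) ht hu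
  comp_neutral t ht hn hred := arrow_comp_neutral ih ht hn hred
  comp_lam U' V' t e ht hinst := by
    obtain ⟨rfl, rfl⟩ := Ty.arrow.inj e
    obtain ⟨W, e', ht'⟩ := ht.lam_inv
    obtain ⟨-, rfl⟩ := Ty.arrow.inj e'
    exact arrow_comp_lam ih ht' hinst

end Arrow

/-! ### Computability at sorts -/

theorem mem_interp_sort_iff {A : S} {t : Pre sig} :
    t ∈ interp (baseInterp sig O P) (.sort A) ↔
      OfType t (.sort A) ∧ ∀ u, Core O P t u → Computable (baseInterp sig O P) u := by
  have h : sortOp O P (baseInterp sig O P) A (baseInterp sig O P A) = baseInterp sig O P A := by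
    rw [baseInterp_eq sig O P A]
    exact OrderHom.map_lfp ⟨sortOp O P (baseInterp sig O P) A, sortOp_mono O P _ A⟩
  rw [interp, ← h]
  simp only [sortOp, Function.update_eq_self]
  refine and_congr_right fun _ => forall_congr' fun u => ⟨fun h hu => ?_, fun h U hu hU => ?_⟩
  · obtain ⟨-, -, U, -, hU, -⟩ := id hu
    exact ⟨U, hU, h U hu hU⟩
  · exact (h hu).mem hU

open Classical in
theorem sort_acc {A : S}
    (ih : ∀ W, WfGt O.gt (.sort A) W → IsComp O P (baseInterp sig O P) W) {t : Pre sig}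
    (ht : t ∈ baseInterp sig O P A) : Acc (Function.swap (Core O P)) t := by
  rw [baseInterp_eq] at ht
  refine OrderHom.lfp_le ⟨sortOp O P (baseInterp sig O P) A, sortOp_mono O P _ A⟩
    (a := {t | Acc (Function.swap (Core O P)) t}) ?_ ht
  rintro s ⟨hs, h⟩
  refine ⟨_, fun u hu => ?_⟩
  obtain ⟨-, -, U, -, hU, -⟩ := id hu
  have h' := h u U hu hU
  rcases Core.type_ge hu hs hU with rfl | hgt
  · rwa [interp, Function.update_self] at h'
  · -- `A` does not occur in `U`, which is smaller: the interpretation of `U` is the final one.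
    rw [interp_congr U (J := baseInterp sig O P) fun B hB => Function.update_of_ne (by
      rintro rfl
      exact O.wfGt_irrefl _ (O.occurs_of_gt hgt hB)) _ _] at h'
    exact (ih U (.single (Or.inl hgt))).acc h'

theorem isComp_sort {A : S}
    (ih : ∀ W, WfGt O.gt (.sort A) W → IsComp O P (baseInterp sig O P) W) :
    IsComp O P (baseInterp sig O P) (.sort A) where
  typed t ht := (mem_interp_sort_iff.1 ht).1
  comp_sn t ht := (mem_SN_iff (mem_interp_sort_iff.1 ht).1).2 (sort_acc ih ht)
  comp_red t ht := (mem_interp_sort_iff.1 ht).2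
  comp_neutral t ht _ hred := mem_interp_sort_iff.2 ⟨ht, hred⟩
  comp_lam U V t e := by cases e

end CPO

theorem mainTheorem5 {S : Type u} {X : Type v} {F : Type w} (sig : CPO.Signature S X F)
    (O : CPO.TypeOrder S) (P : CPO.Precedence F) (T : CPO.Ty S) :
    CPO.IsCompPred (CPO.Core O P) {t | CPO.Neutral t} (CPO.baseInterp sig O P) T
      (CPO.interp (CPO.baseInterp sig O P) T) := by
  induction T using O.sn.induction with
  | _ T ih =>
    cases T with
    | sort A => exact CPO.isComp_sort ih
    | arrow U V => exact CPO.isComp_arrow ih
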